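/- For $1\le p\le\infty$ let $\mathcal B_\pi^p$ be the Bernstein space of entire functions of exponential type at most $\pi$ whose restriction to $\mathbb R$ is bounded, vanishes at infinity and lies in $L^p(\mathbb R)$, with the norm $\|f\|_{\mathcal B_\pi^p}=\|f|_{\mathbb R}\|_{L^p}$. The sampling operator $S_1:\mathcal B_\pi^1\to\ell^1(\mathbb Z)$, $S_1f=(f(k))_{k\in\mathbb Z}$, is injective; its inverse $T_1:\operatorname{img}(S_1)\to\mathcal B_\pi^1$ is called the interpolation operator. Call a sequence $(c_k)_{k\in\mathbb Z}$ of complex numbers elementary computable if it has computable entries and finite support in some $\{-L,\dots,L\}$, and call $\sum_{k=-L}^{L}c_k\,\mathrm{sinc}(z-k)$ with computable $c_k$ an elementary computable function, where $\mathrm{sinc}(z)=\sin(\pi z)/(\pi z)$ and $\mathrm{sinc}(0)=1$. A discrete-time description of $x\in\ell^1(\mathbb Z)$ is a pair $\mathfrak X=((x_n)_{n\in\mathbb N},\xi')$, given by programs, of a computable sequence of elementary computable sequences $x_n$ and a recursive function $\xi':\mathbb N\to\mathbb N$ such that $\|x-x_n\|_{\ell^1}\le 2^{-M}$ whenever $n\ge\xi'(M)$.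 A continuous-time description of $f\in\mathcal B_\pi^1$ is a pair $\mathfrak F=((f_n)_{n\in\mathbb N},\xi)$, given by programs, of a computable sequence of elementary computable functions $f_n\in\mathcal B_\pi^1$ and a recursive function $\xi:\mathbb N\to\mathbb N$ such that $\|f-f_n\|_{\mathcal B_\pi^1}\le 2^{-M}$ whenever $n\ge\xi(M)$. (Each computable real number is given by a computable sequence of rationals together with a recursive modulus of convergence, uniformly in all indices.) Let $\mathcal{CB}_\pi^1$ be the set of all $f\in\mathcal B_\pi^1$ that have a continuous-time description. The interpolation operator $T_1$ is said to be Turing computable if there is a Turing machine that, for every discrete-time description $\mathfrak X$ of a sequence $x$ with $x=S_1f$ for some $f\in\mathcal{CB}_\pi^1$, on input $\mathfrak X$ halts and outputs a continuous-time description of $T_1x=f$. **Theorem.** The interpolation operator $T_1:\operatorname{img}(S_1)\to\mathcal B_\pi^1$ is not Turing computable. -/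

import Mathlib

open MeasureTheory Filter Topology
open scoped ENNReal

/-! ### Bandlimited signals -/

/-- The Bernstein space `B_σ^p`, as a set of functions on `ℂ`: entire functions of exponential type
at most `σ` whose restriction to the real line is essentially bounded, vanishes at infinity and
lies in `L^p(ℝ)`. -/
def bernsteinSpace (σ : ℝ) (p : ℝ≥0∞) : Set (ℂ → ℂ) :=
  {f | Differentiable ℂ f ∧
    (∀ ε : ℝ, 0 < ε → ∃ C : ℝ, ∀ z : ℂ, ‖f z‖ ≤ C * Real.exp ((σ + ε) * ‖z‖)) ∧
    MemLp (fun t : ℝ => f t) ∞ volume ∧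
    Tendsto (fun t : ℝ => f t) (cocompact ℝ) (𝓝 0) ∧
    MemLp (fun t : ℝ => f t) p volume}

/-- The norm of `B_σ^p`: the `L^p`-norm on the real line (with values in `[0, ∞]`). -/
noncomputable def bernsteinNorm (p : ℝ≥0∞) (f : ℂ → ℂ) : ℝ≥0∞ :=
  eLpNorm (fun t : ℝ => f t) p volume

/-- The normalized sinc function on `ℂ`. -/
noncomputable def csinc (z : ℂ) : ℂ :=
  if z = 0 then 1 else Complex.sin (Real.pi * z) / (Real.pi * z)

/-- The sampling operator `S_p : f ↦ (f(k))_{k ∈ ℤ}` on `B_π^p`. -/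
def sampling (p : ℝ≥0∞) (f : bernsteinSpace Real.pi p) : ℤ → ℂ := fun k => f.1 k

/-! ### The sampling operator is injective, so that its inverse is well defined -/

/-- Growth off the real axis, in the half-plane `im z ≥ 0`. -/
theorem norm_le_exp_im_of_nonneg {f : ℂ → ℂ} {σ C : ℝ} (hσ : 0 < σ) (hf : Differentiable ℂ f)
    (ht : ∀ ε : ℝ, 0 < ε → ∃ C : ℝ, ∀ z : ℂ, ‖f z‖ ≤ C * Real.exp ((σ + ε) * ‖z‖))
    (hC : ∀ t : ℝ, ‖f t‖ ≤ C) (z : ℂ) (hz : 0 ≤ z.im) :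
    ‖f z‖ ≤ C * Real.exp (σ * z.im) := by
  have key : ∀ ε : ℝ, 0 < ε → ‖f z‖ ≤ C * Real.exp ((σ + ε) * z.im) := by
    intro ε hε
    obtain ⟨D, hD⟩ := ht (ε / 2) (by positivity)
    have hD0 : 0 ≤ D := by
      have := (norm_nonneg _).trans (hD 0)
      simpa using this
    have hb : ∀ w : ℂ, ‖f (Complex.I * w) * Complex.exp (-(σ + ε : ℝ) * w)‖
        ≤ D * Real.exp ((σ + ε / 2) * ‖w‖ - (σ + ε) * w.re) := by
      intro w
      have h1 := hD (Complex.I * w)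
      rw [norm_mul, Complex.norm_exp, sub_eq_add_neg, Real.exp_add, ← mul_assoc]
      have h2 : (-(σ + ε : ℝ) * w : ℂ).re = -((σ + ε) * w.re) := by simp; ring
      rw [h2]
      gcongr
      simpa using h1
    have := PhragmenLindelof.right_half_plane_of_tendsto_zero_on_real
      (f := fun w => f (Complex.I * w) * Complex.exp (-(σ + ε : ℝ) * w)) (C := C)
      (z := -Complex.I * z) ?_ ⟨1, by norm_num, σ + ε / 2, ?_⟩ ?_ ?_ ?_
    · have h1 : Complex.I * (-Complex.I * z) = z := by
        rw [← mul_assoc]; simp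
      simp only [h1, norm_mul, Complex.norm_exp] at this
      have h2 : (-(σ + ε : ℝ) * (-Complex.I * z) : ℂ).re = -((σ + ε) * z.im) := by
        simp; ring
      rw [h2, Real.exp_neg, ← div_eq_mul_inv, div_le_iff₀ (Real.exp_pos _)] at this
      exact this
    · apply Differentiable.diffContOnCl
      fun_prop
    · refine Asymptotics.IsBigO.of_bound D ?_
      rw [eventually_inf_principal]
      refine Eventually.of_forall fun w hw => ?_
      refine (hb w).trans ?_
      rw [Real.norm_eq_abs, abs_of_pos (Real.exp_pos _), Real.rpow_one]
      gcongr
      have : 0 < w.re := hw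
      nlinarith
    · have h3 : Tendsto (fun x : ℝ => D * Real.exp (-((ε / 2) * x))) atTop (𝓝 (D * 0)) := by
        refine Tendsto.const_mul _ (Real.tendsto_exp_neg_atTop_nhds_zero.comp ?_)
        exact tendsto_id.const_mul_atTop (by positivity)
      rw [mul_zero] at h3
      refine squeeze_zero_norm' ?_ h3
      filter_upwards [eventually_ge_atTop 0] with x hx
      refine (hb x).trans (le_of_eq ?_)
      simp only [Complex.norm_real, Real.norm_eq_abs, abs_of_nonneg hx, Complex.ofReal_re]
      ring_nf
    · intro x
      have h4 : Complex.I * (x * Complex.I) = ((-x : ℝ) : ℂ) := by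
        push_cast; ring_nf; simp
      rw [norm_mul, h4, Complex.norm_exp]
      have h5 : (-(σ + ε : ℝ) * (x * Complex.I) : ℂ).re = 0 := by simp
      rw [h5, Real.exp_zero, mul_one]
      exact hC _
    · simpa using hz
  have lim : Tendsto (fun ε : ℝ => C * Real.exp ((σ + ε) * z.im)) (𝓝[>] 0)
      (𝓝 (C * Real.exp ((σ + 0) * z.im))) := by
    apply Tendsto.mono_left _ nhdsWithin_le_nhds
    apply Continuous.tendsto
    fun_prop
  rw [add_zero] at lim
  exact ge_of_tendsto lim (eventually_nhdsWithin_of_forall fun ε hε => key ε hε)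

theorem norm_le_exp_abs_im {f : ℂ → ℂ} {σ C : ℝ} (hσ : 0 < σ) (hf : Differentiable ℂ f)
    (ht : ∀ ε : ℝ, 0 < ε → ∃ C : ℝ, ∀ z : ℂ, ‖f z‖ ≤ C * Real.exp ((σ + ε) * ‖z‖))
    (hC : ∀ t : ℝ, ‖f t‖ ≤ C) (z : ℂ) :
    ‖f z‖ ≤ C * Real.exp (σ * |z.im|) := by
  rcases le_total 0 z.im with h | h
  · rw [abs_of_nonneg h]
    exact norm_le_exp_im_of_nonneg hσ hf ht hC z h
  · rw [abs_of_nonpos h]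
    have := norm_le_exp_im_of_nonneg (f := fun w => f (-w)) (C := C) hσ (by fun_prop)
      (fun ε hε => (ht ε hε).imp fun D hD w => by simpa using hD (-w))
      (fun t => by simpa using hC (-t)) (-z) (by simpa using h)
    simpa using this

theorem exp_le_four_mul_norm_sin (z : ℂ) (hz : 1 ≤ |z.im|) :
    Real.exp (Real.pi * |z.im|) ≤ 4 * ‖Complex.sin (Real.pi * z)‖ := by
  have e : Complex.exp (-(Real.pi * z) * Complex.I) - Complex.exp (Real.pi * z * Complex.I)
      = -2 * Complex.I * Complex.sin (Real.pi * z) := by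
    rw [Complex.sin]; ring_nf; simp; ring
  have n := congrArg norm e
  simp only [norm_mul, norm_neg, Complex.norm_I, mul_one, Complex.norm_ofNat] at n
  have a1 : ‖Complex.exp (-(Real.pi * z) * Complex.I)‖ = Real.exp (Real.pi * z.im) := by
    rw [Complex.norm_exp]; simp
  have a2 : ‖Complex.exp ((Real.pi * z) * Complex.I)‖ = Real.exp (-(Real.pi * z.im)) := by
    rw [Complex.norm_exp]; simp
  have small : ∀ y : ℝ, 1 ≤ y → 2 * Real.exp (-(Real.pi * y)) ≤ Real.exp (Real.pi * y) := by
    intro y hy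
    have h3 : 3 ≤ Real.pi * y := by nlinarith [Real.pi_gt_three]
    have h1 : Real.exp (-(Real.pi * y)) ≤ 1 := by
      rw [Real.exp_le_one_iff]; linarith
    have h2 := Real.add_one_le_exp (Real.pi * y)
    linarith
  rcases le_total 0 z.im with h | h
  · rw [abs_of_nonneg h] at hz ⊢
    have t := norm_sub_norm_le (Complex.exp (-(Real.pi * z) * Complex.I))
      (Complex.exp (Real.pi * z * Complex.I))
    rw [a1, a2, n] at t
    linarith [small _ hz]
  · rw [abs_of_nonpos h] at hz ⊢
    have t := norm_sub_norm_le (Complex.exp (Real.pi * z * Complex.I))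
      (Complex.exp (-(Real.pi * z) * Complex.I))
    rw [norm_sub_rev, a1, a2, n] at t
    have s := small _ hz
    simp only [mul_neg, neg_neg] at s ⊢
    linarith

theorem one_le_norm_sin (z : ℂ) (k : ℤ) (hz : z.re = k + 1 / 2) :
    1 ≤ ‖Complex.sin (Real.pi * z)‖ := by
  have h1 : (Complex.sin (Real.pi * z)).re
      = Real.sin (Real.pi * z.re) * Real.cosh (Real.pi * z.im) := by
    have e : (Real.pi : ℂ) * z = (Real.pi * z.re : ℝ) + (Real.pi * z.im : ℝ) * Complex.I := by
      conv_lhs => rw [← Complex.re_add_im z]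
      push_cast; ring
    rw [e, Complex.sin_add_mul_I, ← Complex.ofReal_sin, ← Complex.ofReal_cosh,
      ← Complex.ofReal_cos, ← Complex.ofReal_sinh, ← Complex.ofReal_mul, ← Complex.ofReal_mul,
      Complex.add_re, Complex.ofReal_re, Complex.re_ofReal_mul, Complex.I_re, mul_zero, add_zero]
  have h2 : |Real.sin (Real.pi * z.re)| = 1 := by
    have : Real.pi * z.re = k * Real.pi + Real.pi / 2 := by rw [hz]; ring
    rw [this, Real.sin_add_pi_div_two, Real.abs_cos_int_mul_pi]
  calc (1 : ℝ) ≤ |Real.sin (Real.pi * z.re)| * |Real.cosh (Real.pi * z.im)| := by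
        rw [h2, one_mul]; exact (Real.one_le_cosh _).trans (le_abs_self _)
    _ = |(Complex.sin (Real.pi * z)).re| := by rw [h1, abs_mul]
    _ ≤ _ := Complex.abs_re_le_norm _

/-- The integers are a set of uniqueness for signals of bandwidth `π` that vanish at infinity. -/
theorem eq_zero_of_samples_eq_zero {f : ℂ → ℂ} {p : ℝ≥0∞} (hf : f ∈ bernsteinSpace Real.pi p)
    (h0 : ∀ k : ℤ, f k = 0) : f = 0 := by
  obtain ⟨hd, ht, -, hv, -⟩ := hf
  obtain ⟨C, hC⟩ : ∃ C, ∀ t : ℝ, ‖f t‖ ≤ C := by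
    have hc : Continuous fun t : ℝ => f t := hd.continuous.comp Complex.continuous_ofReal
    obtain ⟨C, hC⟩ := (ZeroAtInftyContinuousMap.isBounded_range
      (⟨⟨fun t : ℝ => f t, hc⟩, hv⟩ : ZeroAtInftyContinuousMap ℝ ℂ)).exists_norm_le
    exact ⟨C, fun t => hC _ ⟨t, rfl⟩⟩
  have hC0 : 0 ≤ C := (norm_nonneg _).trans (hC 0)
  have hb := norm_le_exp_abs_im Real.pi_pos hd ht hC
  set s : ℂ → ℂ := fun z => Complex.sin (Real.pi * z) with hs
  have sd : Differentiable ℂ s := by simp only [hs]; fun_prop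
  have hpi : (Real.pi : ℂ) ≠ 0 := by exact_mod_cast Real.pi_ne_zero
  have s0 : ∀ z, s z = 0 ↔ ∃ k : ℤ, z = k := by
    intro z
    simp only [hs, Complex.sin_eq_zero_iff]
    refine exists_congr fun k => ?_
    rw [mul_comm (k : ℂ)]
    exact mul_right_inj' hpi
  have sk : ∀ k : ℤ, deriv s k ≠ 0 := by
    intro k
    have : HasDerivAt s (Complex.cos (Real.pi * k) * (Real.pi * 1)) k :=
      ((hasDerivAt_id (k : ℂ)).const_mul (Real.pi : ℂ)).csin
    rw [this.deriv, mul_one]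
    refine mul_ne_zero (fun h => ?_) hpi
    have h2 := Complex.sin_sq_add_cos_sq (Real.pi * k : ℂ)
    have h3 : Complex.sin (Real.pi * k : ℂ) = 0 := (s0 k).2 ⟨k, rfl⟩
    rw [h, h3] at h2
    norm_num at h2
  let q : ℂ → ℂ := fun z => if s z = 0 then deriv f z / deriv s z else f z / s z
  have qd : Differentiable ℂ q := by
    intro z
    by_cases hz : s z = 0
    · obtain ⟨k, rfl⟩ := (s0 z).1 hz
      have dd : ∀ g : ℂ → ℂ, Differentiable ℂ g → Differentiable ℂ (dslope g (k : ℂ)) := by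
        intro g hg
        rw [← differentiableOn_univ]
        exact (Complex.differentiableOn_dslope univ_mem).2 hg.differentiableOn
      have nz : dslope s (k : ℂ) k ≠ 0 := by rw [dslope_same]; exact sk k
      have ev : q =ᶠ[𝓝 (k : ℂ)] fun z => dslope f k z / dslope s k z := by
        have e1 := (dd s sd).continuous.continuousAt.eventually_ne nz
        filter_upwards [e1] with w hw
        by_cases hwk : w = k
        · subst hwk
          simp only [q, hz, if_true, dslope_same]
        · have hsw : s w = (w - k) * dslope s k w := by
            have := sub_smul_dslope s (k : ℂ) w
            rw [hz, sub_zero, smul_eq_mul] at this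
            exact this.symm
          have hfw : f w = (w - k) * dslope f k w := by
            have := sub_smul_dslope f (k : ℂ) w
            rw [h0, sub_zero, smul_eq_mul] at this
            exact this.symm
          have hne : w - k ≠ 0 := sub_ne_zero.2 hwk
          have : s w ≠ 0 := by rw [hsw]; exact mul_ne_zero hne hw
          simp only [q, if_neg this]
          rw [hsw, hfw, mul_div_mul_left _ _ hne]
      exact (((dd f hd) _).div ((dd s sd) _) nz).congr_of_eventuallyEq ev
    · have ev : q =ᶠ[𝓝 z] fun z => f z / s z := by
        filter_upwards [sd.continuous.continuousAt.eventually_ne hz] with w hw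
        simp only [q, if_neg hw]
      exact ((hd z).div (sd z) hz).congr_of_eventuallyEq ev
  have qn : ∀ z, ∀ K : ℝ, 0 < ‖s z‖ → ‖f z‖ ≤ K * ‖s z‖ → ‖q z‖ ≤ K := by
    intro z K h1 h2
    simp only [q, if_neg (norm_pos_iff.1 h1), norm_div]
    exact (div_le_iff₀ h1).2 h2
  set K : ℝ := 4 * C + C * Real.exp Real.pi with hK
  have far : ∀ z : ℂ, 1 ≤ |z.im| → ‖q z‖ ≤ K := by
    intro z hz
    have h1 := exp_le_four_mul_norm_sin z hz
    have h2 := Real.exp_pos (Real.pi * |z.im|)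
    refine (qn z (4 * C) (by simp only [hs]; linarith) ((hb z).trans ?_)).trans ?_
    · simp only [hs]; nlinarith
    · have := mul_nonneg hC0 (Real.exp_pos Real.pi).le
      linarith
  have line : ∀ z : ℂ, |z.im| ≤ 1 → ∀ k : ℤ, z.re = k + 1 / 2 → ‖q z‖ ≤ K := by
    intro z hz k hk
    have h1 : 1 ≤ ‖s z‖ := one_le_norm_sin z k hk
    have h3 : C * Real.exp (Real.pi * |z.im|) ≤ C * Real.exp Real.pi := by
      gcongr
      nlinarith [Real.pi_pos]
    have h4 := mul_nonneg hC0 (Real.exp_pos Real.pi).le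
    refine (qn z (C * Real.exp Real.pi) (by linarith) ((hb z).trans ?_)).trans (by linarith)
    nlinarith
  have qb : ∀ z, ‖q z‖ ≤ K := by
    intro z
    by_cases hz : 1 ≤ |z.im|
    · exact far z hz
    push Not at hz
    set k : ℤ := ⌊z.re - 1 / 2⌋ with hk
    have k1 : (k : ℝ) ≤ z.re - 1 / 2 := Int.floor_le _
    have k2 : z.re - 1 / 2 < k + 1 := Int.lt_floor_add_one _
    have ab : (k + 1 / 2 : ℝ) < k + 3 / 2 := by linarith
    refine Complex.norm_le_of_forall_mem_frontier_norm_le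
      (U := Set.Ioo (k + 1 / 2 : ℝ) (k + 3 / 2) ×ℂ Set.Ioo (-1 : ℝ) 1)
      ((Metric.isBounded_Ioo _ _).reProdIm (Metric.isBounded_Ioo _ _)) qd.diffContOnCl ?_ ?_
    · intro w hw
      rw [Complex.frontier_reProdIm, frontier_Ioo ab, frontier_Ioo (by norm_num : (-1 : ℝ) < 1),
        closure_Ioo ab.ne, closure_Ioo (by norm_num : (-1 : ℝ) ≠ 1)] at hw
      rcases hw with ⟨-, hw⟩ | ⟨hw, hw'⟩
      · apply far
        rcases hw with hw | hw
        · have : w.im = -1 := hw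
          rw [this]; norm_num
        · have : w.im = 1 := hw
          rw [this]; norm_num
      · have hi : |w.im| ≤ 1 := abs_le.2 hw'
        rcases hw with hw | hw
        · exact line w hi k hw
        · refine line w hi (k + 1) ?_
          have : w.re = k + 3 / 2 := hw
          rw [this]; push_cast; ring
    · rw [Complex.closure_reProdIm, closure_Ioo ab.ne, closure_Ioo (by norm_num : (-1 : ℝ) ≠ 1)]
      rw [abs_lt] at hz
      refine ⟨⟨?_, ?_⟩, ⟨?_, ?_⟩⟩ <;> linarith
  have qc : ∀ z, q z = q 0 := by
    intro z
    refine qd.apply_eq_apply_of_bounded ?_ z 0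
    rw [isBounded_iff_forall_norm_le]
    exact ⟨K, by rintro _ ⟨w, rfl⟩; exact qb w⟩
  have hq0 : q 0 = 0 := by
    have tr : Tendsto (fun n : ℕ => ‖f (((n : ℝ) + 1 / 2 : ℝ) : ℂ)‖) atTop (𝓝 0) := by
      have t1 : Tendsto (fun n : ℕ => (n : ℝ) + 1 / 2) atTop (cocompact ℝ) :=
        (tendsto_atTop_add_const_right _ _ tendsto_natCast_atTop_atTop).mono_right
          atTop_le_cocompact
      simpa using (hv.comp t1).norm
    have le : ∀ n : ℕ, ‖q 0‖ ≤ ‖f (((n : ℝ) + 1 / 2 : ℝ) : ℂ)‖ := by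
      intro n
      have h1 : 1 ≤ ‖s (((n : ℝ) + 1 / 2 : ℝ) : ℂ)‖ :=
        one_le_norm_sin _ (n : ℤ) (by rw [Complex.ofReal_re]; push_cast; rfl)
      rw [← qc (((n : ℝ) + 1 / 2 : ℝ) : ℂ)]
      exact qn _ _ (by linarith) (le_mul_of_one_le_right (norm_nonneg _) h1)
    exact norm_le_zero_iff.1 (ge_of_tendsto' tr le)
  funext z
  by_cases hz : s z = 0
  · obtain ⟨k, rfl⟩ := (s0 z).1 hz
    exact h0 k
  · have := qc z
    rw [hq0] at this
    simp only [q, if_neg hz, div_eq_zero_iff, hz, or_false] at this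
    exact this

theorem sampling_injective (p : ℝ≥0∞) : Function.Injective (sampling p) := by
  intro f g hfg
  have hd : f.1 - g.1 ∈ bernsteinSpace Real.pi p := by
    obtain ⟨f, f1, f2, f3, f4, f5⟩ := f
    obtain ⟨g, g1, g2, g3, g4, g5⟩ := g
    refine ⟨f1.sub g1, fun ε hε => ?_, f3.sub g3, by simpa using f4.sub g4, f5.sub g5⟩
    obtain ⟨C, hC⟩ := f2 ε hε
    obtain ⟨D, hD⟩ := g2 ε hε
    refine ⟨C + D, fun z => (norm_sub_le _ _).trans ?_⟩
    rw [add_mul]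
    exact add_le_add (hC z) (hD z)
  exact Subtype.ext <| sub_eq_zero.1 <| eq_zero_of_samples_eq_zero hd fun k =>
    sub_eq_zero.2 (congrFun hfg k)

/-- The interpolation operator `T_p : img(S_p) → B_π^p`, the inverse of the sampling operator. -/
noncomputable def interpolation (p : ℝ≥0∞) :
    Set.range (sampling p) → bernsteinSpace Real.pi p :=
  (Equiv.ofInjective (sampling p) (sampling_injective p)).symm

/-! ### Machine-readable descriptions

A description is a tuple of programs; a program is a code for a partial recursive function.
Families are indexed by a type `ι` with a fixed effective coding (such as `ℕ × ℤ`), and a family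
of numbers is described by programs that are uniform in the index. -/

/-- Programs. -/
abbrev Program := Nat.Partrec.Code

/-- The program `P` computes the (total) function `g`. -/
def Computes {ι : Type} [Primcodable ι] (P : Program) (g : ι → ℕ) : Prop :=
  ∀ i, g i ∈ P.eval (Encodable.encode i)

/-- Programs for sign, numerator and denominator. -/
abbrev RationalProgram := Program × Program × Program

/-- `P` generates the family of rationals `r i = (-1)^{si i} * nu i / de i`. -/
def DescribesRational {ι : Type} [Primcodable ι] (P : RationalProgram) (r : ι → ℚ) : Prop :=
  ∃ si nu de : ι → ℕ, Computes P.1 si ∧ Computes P.2.1 nu ∧ Computes P.2.2 de ∧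
    ∀ i, de i ≠ 0 ∧ r i = (-1) ^ si i * nu i / de i

/-- Programs for a sequence of rationals and for a modulus of convergence. -/
abbrev RealProgram := RationalProgram × Program

/-- Standard description of a family of real numbers: rationals `r (i, n)` that converge to `x i`
effectively, with the recursive modulus of convergence `M ↦ ξ (i, M)`. -/
def DescribesReal {ι : Type} [Primcodable ι] (P : RealProgram) (x : ι → ℝ) : Prop :=
  ∃ (r : ι × ℕ → ℚ) (ξ : ι × ℕ → ℕ), DescribesRational P.1 r ∧ Computes P.2 ξ ∧
    ∀ (i : ι) (n M : ℕ), ξ (i, M) ≤ n → |x i - r (i, n)| ≤ (1 / 2 : ℝ) ^ M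

/-- Programs for the real and the imaginary parts. -/
abbrev ComplexProgram := RealProgram × RealProgram

/-- Standard description of a family of complex numbers. -/
def DescribesComplex {ι : Type} [Primcodable ι] (P : ComplexProgram) (c : ι → ℂ) : Prop :=
  DescribesReal P.1 (fun i => (c i).re) ∧ DescribesReal P.2 (fun i => (c i).im)

/-- The finite sequence with entries `c k` for `-L ≤ k ≤ L` and `0` elsewhere. -/
def elementarySequence (L : ℕ) (c : ℤ → ℂ) : ℤ → ℂ :=
  fun k => if -(L : ℤ) ≤ k ∧ k ≤ L then c k else 0

/-- The finite Shannon sampling series with coefficients `c k`, `-L ≤ k ≤ L`. -/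
noncomputable def elementarySignal (L : ℕ) (c : ℤ → ℂ) : ℂ → ℂ :=
  fun z => ∑ k ∈ Finset.Icc (-(L : ℤ)) L, c k * csinc (z - k)

/-- Programs for the lengths `L n`, for the coefficients `c (n, k)`, and for a modulus of
convergence. Discrete-time and continuous-time descriptions have this same shape. -/
abbrev SignalProgram := (Program × ComplexProgram) × Program

/-- `X` is a description, in the language of `ℓ^1`, of the sequence `x ∈ ℓ^1`: it generates a
computable sequence of elementary computable sequences that converges to `x` in `ℓ^1` effectively,
with a recursive modulus of convergence. -/
def DescribesSequence (X : SignalProgram) (x : ℤ → ℂ) : Prop :=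
  Memℓp x 1 ∧
  ∃ (L : ℕ → ℕ) (c : ℕ × ℤ → ℂ) (ξ : ℕ → ℕ),
    Computes X.1.1 L ∧ DescribesComplex X.1.2 c ∧ Computes X.2 ξ ∧
    ∀ n M : ℕ, ξ M ≤ n →
      ∑' k : ℤ, ‖x k - elementarySequence (L n) (fun k => c (n, k)) k‖ₑ ≤ (1 / 2 : ℝ≥0∞) ^ M

/-- `F` is a description, in the language of `B_π^1`, of the signal `f ∈ B_π^1`: it generates a
computable sequence of elementary computable signals in `B_π^1` that converges to `f` in the norm of
`B_π^1` effectively, with a recursive modulus of convergence. -/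
def DescribesSignal (F : SignalProgram) (f : ℂ → ℂ) : Prop :=
  f ∈ bernsteinSpace Real.pi 1 ∧
  ∃ (L : ℕ → ℕ) (c : ℕ × ℤ → ℂ) (ξ : ℕ → ℕ),
    Computes F.1.1 L ∧ DescribesComplex F.1.2 c ∧ Computes F.2 ξ ∧
    (∀ n : ℕ, elementarySignal (L n) (fun k => c (n, k)) ∈ bernsteinSpace Real.pi 1) ∧
    ∀ n M : ℕ, ξ M ≤ n →
      bernsteinNorm 1 (f - elementarySignal (L n) (fun k => c (n, k))) ≤ (1 / 2 : ℝ≥0∞) ^ M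

/-- The set `CB_π^1` of computable signals in `B_π^1`. -/
def computableSignals : Set (ℂ → ℂ) := {f | ∃ F : SignalProgram, DescribesSignal F f}

/-- Turing computability of an operator `T : img(S_1) → B_π^1`: some algorithm (a partial recursive
function on descriptions) turns every description `X` of a sequence `x` that is the sampling
sequence of a signal in `CB_π^1` into a description of the signal `T x`. On other inputs the
algorithm may do anything, in particular run forever. -/
def IsTuringComputable
    (T : Set.range (sampling 1) → bernsteinSpace Real.pi 1) : Prop :=
  ∃ Φ : SignalProgram →. SignalProgram, Partrec Φ ∧
    ∀ (X : SignalProgram) (x : Set.range (sampling 1)),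
      DescribesSequence X x →
      (∃ f : bernsteinSpace Real.pi 1, f.1 ∈ computableSignals ∧ sampling 1 f = x) →
      ∃ F ∈ Φ X, DescribesSignal F (T x)

/-! Interpolation is unbounded from `ℓ^1` to `B_π^1`: the signal sinc(z - a) + sinc(z - b) with b -
a odd has samples of `ℓ^1`-norm 2, whereas its `L^1`-norm grows at least like log (b - a)
(`harmonic_le_integral_norm_csincPair`). Scaling by 2⁻ᴺ and taking b - a doubly exponential in N
gives `spike N`, whose samples are small but whose `L^1`-norm exceeds 1/2 on an interval far from
the origin.

This encodes the halting problem. For a program `e`, `haltSignal e n` is zero until `e` is seen to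
halt, and is `spike N` once the halting bound N has been found. In `ℓ^1` the error made before that
moment is at most 2 * 2⁻ᴺ, so there is a modulus of convergence independent of `e`, and a
discrete-time description is computable from `e` (`exists_computable_haltSignal_program`,
`describesSequence_of_haltSignal`). The limit is always a computable signal: it is an elementary
one.

A continuous-time description, however, reveals a bound on N. By
`quarter_lt_bernsteinNorm_spike_sub`, no Shannon series of length at most N lies within 1/4 of
`spike N`: the Nikolskii inequality bounds its coefficients, and a series with few bounded
coefficients is negligible near the remote nodes. Hence the length of the approximant of accuracy
1/4 exceeds N, and an algorithm for interpolation would yield a computable bound on halting times.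
-/

/-! ### A Nikolskii inequality -/

/-- Signals of exponential type are closed under primitives. -/
theorem exponentialType_of_hasDerivAt {f F : ℂ → ℂ} {σ : ℝ}
    (hF : ∀ z, HasDerivAt F (f z) z)
    (ht : ∀ ε : ℝ, 0 < ε → ∃ C : ℝ, ∀ z : ℂ, ‖f z‖ ≤ C * Real.exp ((σ + ε) * ‖z‖))
    (hσ : 0 < σ) (h0 : F 0 = 0) :
    ∀ ε : ℝ, 0 < ε → ∃ C : ℝ, ∀ z : ℂ, ‖F z‖ ≤ C * Real.exp ((σ + ε) * ‖z‖) := by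
  intro ε hε
  obtain ⟨C, hC⟩ := ht (ε / 2) (by positivity)
  have hC0 : 0 ≤ C := by simpa using (norm_nonneg _).trans (hC 0)
  -- The mean value inequality costs a factor `‖z‖`, which the unused half of `ε` absorbs: `‖z‖ ≤ 2
  -- / ε * exp (ε / 2 * ‖z‖)`.
  refine ⟨C * (2 / ε), fun z => ?_⟩
  have hb : ∀ w ∈ Metric.closedBall (0 : ℂ) ‖z‖, ‖f w‖ ≤ C * Real.exp ((σ + ε / 2) * ‖z‖) := by
    intro w hw
    refine (hC w).trans ?_
    rw [mem_closedBall_zero_iff] at hw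
    gcongr
  have hm := (convex_closedBall (0 : ℂ) ‖z‖).norm_image_sub_le_of_norm_hasDerivWithin_le
    (fun w _ => (hF w).hasDerivWithinAt) hb (x := 0) (y := z) (by simp) (by simp)
  rw [h0, sub_zero, sub_zero] at hm
  refine hm.trans ?_
  have h1 : ‖z‖ ≤ 2 / ε * Real.exp (ε / 2 * ‖z‖) := by
    have := Real.add_one_le_exp (ε / 2 * ‖z‖)
    rw [div_mul_eq_mul_div, le_div_iff₀ hε]
    linarith
  have h2 : Real.exp ((σ + ε) * ‖z‖) = Real.exp ((σ + ε / 2) * ‖z‖) * Real.exp (ε / 2 * ‖z‖) := by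
    rw [← Real.exp_add]; ring_nf
  calc C * Real.exp ((σ + ε / 2) * ‖z‖) * ‖z‖
      ≤ C * Real.exp ((σ + ε / 2) * ‖z‖) * (2 / ε * Real.exp (ε / 2 * ‖z‖)) := by gcongr
    _ = _ := by rw [h2]; ring

/-- On the real line the primitive of `f` vanishing at 0 is bounded by the `L^1`-norm of `f`, and it
has the same exponential type. Its growth off the axis is therefore controlled, and Cauchy's
estimate on a unit circle bounds its derivative `f`. -/
theorem norm_le_exp_mul_integral_norm {f : ℂ → ℂ} {σ : ℝ} (hσ : 0 < σ)
    (hf : f ∈ bernsteinSpace σ 1) (x : ℝ) :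
    ‖f x‖ ≤ Real.exp σ * ∫ t : ℝ, ‖f t‖ := by
  obtain ⟨hd, ht, -, -, h1⟩ := hf
  have hi : Integrable (fun t : ℝ => f t) := memLp_one_iff_integrable.1 h1
  obtain ⟨F, hF0, hF⟩ : ∃ F : ℂ → ℂ, F 0 = 0 ∧ ∀ z, HasDerivAt F (f z) z := by
    obtain ⟨F, hF0, hF⟩ := hd.isExactOn_univ.with_val_at 0 0
    exact ⟨F, hF0, fun z => hF z (Set.mem_univ _)⟩
  have hFd : Differentiable ℂ F := fun z => (hF z).differentiableAt
  set C := ∫ t : ℝ, ‖f t‖ with hC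
  have hb : ∀ t : ℝ, ‖F t‖ ≤ C := by
    intro t
    have e : ∫ s in (0 : ℝ)..t, f s = F t - F (0 : ℝ) :=
      intervalIntegral.integral_eq_sub_of_hasDerivAt (f := fun s : ℝ => F s)
        (fun s _ => (hF s).comp_ofReal) hi.intervalIntegrable
    rw [Complex.ofReal_zero, hF0, sub_zero] at e
    rw [← e]
    refine (intervalIntegral.norm_integral_le_integral_norm_uIoc).trans ?_
    exact setIntegral_le_integral hi.norm (Eventually.of_forall fun _ => norm_nonneg _)
  have hC0 : 0 ≤ C := (norm_nonneg _).trans (hb 0)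
  have hall := norm_le_exp_abs_im hσ hFd (exponentialType_of_hasDerivAt hF ht hσ hF0) hb
  have := Complex.norm_deriv_le_of_forall_mem_sphere_norm_le (c := (x : ℂ)) (R := 1)
    (C := Real.exp σ * C) one_pos hFd.diffContOnCl (fun z hz => by
      refine (hall z).trans ?_
      rw [mul_comm]
      have h2 : |z.im| ≤ 1 := by
        have h3 := Complex.abs_im_le_norm (z - x)
        rw [mem_sphere_iff_norm] at hz
        simpa [hz] using h3
      gcongr
      nlinarith)
  rwa [(hF x).deriv, div_one] at this

/-! ### The sinc function -/

theorem differentiable_csinc : Differentiable ℂ csinc := by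
  have hpi : (Real.pi : ℂ) ≠ 0 := by exact_mod_cast Real.pi_ne_zero
  have sd : Differentiable ℂ fun z : ℂ => Complex.sin (Real.pi * z) := by fun_prop
  have e : csinc = fun z => dslope (fun z : ℂ => Complex.sin (Real.pi * z)) 0 z / Real.pi := by
    funext z
    by_cases hz : z = 0
    · subst hz
      have : HasDerivAt (fun z : ℂ => Complex.sin (Real.pi * z))
          (Complex.cos (Real.pi * 0) * (Real.pi * 1)) 0 :=
        ((hasDerivAt_id (0 : ℂ)).const_mul (Real.pi : ℂ)).csin
      rw [dslope_same, this.deriv]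
      simp [csinc, hpi]
    · rw [dslope_of_ne _ hz, slope_def_field]
      simp only [csinc, if_neg hz, mul_zero, Complex.sin_zero, sub_zero]
      rw [div_div, mul_comm]
  rw [e]
  refine Differentiable.div_const ?_ _
  rw [← differentiableOn_univ]
  exact (Complex.differentiableOn_dslope univ_mem).2 sd.differentiableOn

theorem csinc_intCast (k : ℤ) : csinc k = if k = 0 then 1 else 0 := by
  by_cases hk : k = 0
  · simp [csinc, hk]
  · rw [csinc, if_neg (by exact_mod_cast hk), if_neg hk, mul_comm (Real.pi : ℂ),
      Complex.sin_int_mul_pi, zero_div]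

theorem norm_sin_le_exp (w : ℂ) : ‖Complex.sin w‖ ≤ Real.exp ‖w‖ := by
  have h1 : ‖Complex.exp (-w * Complex.I)‖ ≤ Real.exp ‖w‖ := by
    simpa using Complex.norm_exp_le_exp_norm (-w * Complex.I)
  have h2 : ‖Complex.exp (w * Complex.I)‖ ≤ Real.exp ‖w‖ := by
    simpa using Complex.norm_exp_le_exp_norm (w * Complex.I)
  have h3 := norm_sub_le (Complex.exp (-w * Complex.I)) (Complex.exp (w * Complex.I))
  rw [Complex.sin, norm_div, norm_mul, Complex.norm_I, mul_one, Complex.norm_ofNat]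
  linarith

theorem exists_norm_csinc_le : ∃ C : ℝ, ∀ z : ℂ, ‖csinc z‖ ≤ C * Real.exp (Real.pi * ‖z‖) := by
  obtain ⟨C, hC⟩ := (isCompact_closedBall (0 : ℂ) 1).exists_bound_of_continuousOn
    differentiable_csinc.continuous.continuousOn
  refine ⟨max C 1, fun z => ?_⟩
  have hp := Real.pi_gt_three
  by_cases hz : ‖z‖ ≤ 1
  · have h1 : 1 ≤ Real.exp (Real.pi * ‖z‖) := Real.one_le_exp (by positivity)
    have h2 := hC z (by simpa using hz)
    have h3 : C ≤ max C 1 := le_max_left _ _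
    nlinarith [le_max_right C 1]
  · push Not at hz
    have hz0 : z ≠ 0 := by rintro rfl; simp at hz; linarith
    rw [csinc, if_neg hz0, norm_div]
    have h1 := norm_sin_le_exp (Real.pi * z)
    have h2 : ‖(Real.pi : ℂ) * z‖ = Real.pi * ‖z‖ := by simp [abs_of_pos Real.pi_pos]
    rw [h2] at h1 ⊢
    calc _ ≤ ‖Complex.sin (Real.pi * z)‖ := div_le_self (norm_nonneg _) (by nlinarith)
      _ ≤ Real.exp (Real.pi * ‖z‖) := h1
      _ ≤ _ := le_mul_of_one_le_left (Real.exp_pos _).le (le_max_right _ _)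

theorem norm_sin_pi_mul_ofReal_le_one (t : ℝ) : ‖Complex.sin (Real.pi * t)‖ ≤ 1 := by
  rw [← Complex.ofReal_mul, ← Complex.ofReal_sin, Complex.norm_real]
  exact Real.abs_sin_le_one _

theorem norm_csinc_ofReal_le {t : ℝ} (ht : 0 < t) : ‖csinc t‖ ≤ 1 / t := by
  rw [csinc, if_neg (by exact_mod_cast ht.ne'), norm_div, norm_mul, Complex.norm_real,
    Complex.norm_real, Real.norm_of_nonneg Real.pi_pos.le, Real.norm_of_nonneg ht.le]
  gcongr
  · exact norm_sin_pi_mul_ofReal_le_one t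
  · nlinarith [Real.pi_gt_three]

/-! ### Pairs of nodes at odd distance -/

/-- The sum of two translates of `csinc`. -/
noncomputable def csincPair (a b : ℤ) : ℂ → ℂ := fun z => csinc (z - a) + csinc (z - b)

theorem differentiable_csincPair (a b : ℤ) : Differentiable ℂ (csincPair a b) :=
  (differentiable_csinc.comp (differentiable_id.sub_const _)).add
    (differentiable_csinc.comp (differentiable_id.sub_const _))

/-- The odd distance flips the sign of the sine at the second node, so the 1/z tails cancel and
quadratic decay remains. This makes the pair integrable, which a single sinc is not. -/
theorem csincPair_eq {a b : ℤ} (hab : Odd (b - a)) {z : ℂ} (ha : z ≠ a) (hb : z ≠ b) :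
    csincPair a b z =
      Complex.sin (Real.pi * (z - a)) / Real.pi * ((a - b) / ((z - a) * (z - b))) := by
  obtain ⟨m, hm⟩ := hab
  have hpi : (Real.pi : ℂ) ≠ 0 := by exact_mod_cast Real.pi_ne_zero
  have ha' := sub_ne_zero.2 ha
  have hb' := sub_ne_zero.2 hb
  have e : (Real.pi : ℂ) * (z - b) = Real.pi * (z - a) - Real.pi - (m : ℤ) * (2 * Real.pi) := by
    have : (b : ℂ) = 2 * m + 1 + a := by
      have := congrArg (Int.cast (R := ℂ)) hm
      push_cast at this
      linear_combination this
    rw [this]; ring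
  rw [csincPair, csinc, csinc, if_neg ha', if_neg hb', e, Complex.sin_sub_int_mul_two_pi,
    Complex.sin_sub_pi, ← e]
  field_simp
  ring

theorem csincPair_isBigO {a b : ℤ} (hab : Odd (b - a)) :
    (fun t : ℝ => csincPair a b t) =O[cocompact ℝ] fun t : ℝ => (1 + t ^ 2)⁻¹ := by
  refine Asymptotics.IsBigO.of_bound (8 * |(a : ℝ) - b|) ?_
  -- Beyond this threshold `|t| ≥ 1` and both distances are at least `|t| / 2`, so `1 + t ^ 2 ≤ 2 *
  -- t ^ 2 ≤ 8 * (|t - a| * |t - b|)`.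
  have hev : ∀ᶠ t : ℝ in cocompact ℝ, 1 + 2 * |(a : ℝ)| + 2 * |(b : ℝ)| ≤ ‖t‖ :=
    tendsto_norm_cocompact_atTop.eventually_ge_atTop _
  filter_upwards [hev] with t ht
  rw [Real.norm_eq_abs] at ht
  have h1 : |t| / 2 ≤ |t - a| := by
    have := abs_sub_abs_le_abs_sub t a
    linarith [abs_nonneg (a : ℝ), abs_nonneg (b : ℝ)]
  have h2 : |t| / 2 ≤ |t - b| := by
    have := abs_sub_abs_le_abs_sub t b
    linarith [abs_nonneg (a : ℝ), abs_nonneg (b : ℝ)]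
  have h0 : 1 ≤ |t| := by linarith [abs_nonneg (a : ℝ), abs_nonneg (b : ℝ)]
  have ha : (t : ℂ) ≠ a := by
    intro h
    have : t = a := by exact_mod_cast h
    rw [this, sub_self, abs_zero] at h1
    rw [← this] at h1
    linarith
  have hb : (t : ℂ) ≠ b := by
    intro h
    have : t = b := by exact_mod_cast h
    rw [this, sub_self, abs_zero] at h2
    rw [← this] at h2
    linarith
  rw [csincPair_eq hab ha hb]
  have n1 : ‖((a : ℂ) - b) / ((t - a) * (t - b))‖ = |(a : ℝ) - b| / (|t - a| * |t - b|) := by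
    rw [norm_div, norm_mul]
    simp only [← Complex.ofReal_intCast, ← Complex.ofReal_sub, Complex.norm_real,
      Real.norm_eq_abs]
  have n2 : ‖Complex.sin (Real.pi * (t - a)) / Real.pi‖ ≤ 1 := by
    rw [norm_div, Complex.norm_real, Real.norm_of_nonneg Real.pi_pos.le,
      div_le_one Real.pi_pos]
    have := norm_sin_pi_mul_ofReal_le_one (t - a)
    push_cast at this
    linarith [Real.pi_gt_three]
  rw [norm_mul, n1, Real.norm_of_nonneg (by positivity)]
  have n3 : |(a : ℝ) - b| / (|t - a| * |t - b|) ≤ 8 * |(a : ℝ) - b| * (1 + t ^ 2)⁻¹ := by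
    rw [← div_eq_mul_inv, div_le_div_iff₀ (by nlinarith) (by positivity)]
    have h3 : 1 + t ^ 2 ≤ 8 * (|t - a| * |t - b|) := by
      have : t ^ 2 = |t| ^ 2 := (sq_abs t).symm
      nlinarith
    nlinarith [abs_nonneg ((a : ℝ) - b)]
  refine le_trans ?_ n3
  exact mul_le_of_le_one_left (by positivity) n2

theorem csincPair_mem_bernsteinSpace {a b : ℤ} (hab : Odd (b - a)) :
    csincPair a b ∈ bernsteinSpace Real.pi 1 := by
  have hc : Continuous fun t : ℝ => csincPair a b t :=
    (differentiable_csincPair a b).continuous.comp Complex.continuous_ofReal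
  have hO := csincPair_isBigO hab
  have hv : Tendsto (fun t : ℝ => csincPair a b t) (cocompact ℝ) (𝓝 0) := by
    refine hO.trans_tendsto ?_
    refine squeeze_zero_norm' ?_ (tendsto_norm_cocompact_atTop (E := ℝ)).inv_tendsto_atTop
    have hev : ∀ᶠ t : ℝ in cocompact ℝ, 1 ≤ ‖t‖ :=
      tendsto_norm_cocompact_atTop.eventually_ge_atTop _
    filter_upwards [hev] with t ht
    rw [Real.norm_of_nonneg (by positivity), Pi.inv_apply]
    rw [Real.norm_eq_abs] at ht ⊢
    have : t ^ 2 = |t| ^ 2 := (sq_abs t).symm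
    gcongr
    nlinarith
  refine ⟨differentiable_csincPair a b, fun ε hε => ?_, ?_, hv, ?_⟩
  · obtain ⟨C, hC⟩ := exists_norm_csinc_le
    have hC0 : 0 ≤ C := by simpa using (norm_nonneg _).trans (hC 0)
    have key : ∀ (a : ℤ) (z : ℂ), ‖csinc (z - a)‖
        ≤ C * Real.exp (Real.pi * ‖(a : ℂ)‖) * Real.exp ((Real.pi + ε) * ‖z‖) := by
      intro a z
      refine (hC _).trans ?_
      rw [mul_assoc, ← Real.exp_add]
      have := norm_sub_le z a
      gcongr
      nlinarith [Real.pi_pos, norm_nonneg z]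
    refine ⟨C * Real.exp (Real.pi * ‖(a : ℂ)‖) + C * Real.exp (Real.pi * ‖(b : ℂ)‖), fun z => ?_⟩
    rw [add_mul]
    exact (norm_add_le _ _).trans (add_le_add (key a z) (key b z))
  · obtain ⟨C, hC⟩ := (ZeroAtInftyContinuousMap.isBounded_range
      (⟨⟨fun t : ℝ => csincPair a b t, hc⟩, hv⟩ : ZeroAtInftyContinuousMap ℝ ℂ)).exists_norm_le
    exact memLp_top_of_bound hc.aestronglyMeasurable C
      (Eventually.of_forall fun t => hC _ ⟨t, rfl⟩)
  · rw [memLp_one_iff_integrable]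
    exact hc.locallyIntegrable.integrable_of_isBigO_cocompact hO
      (integrable_inv_one_add_sq.integrableAtFilter _)

/-! ### Linear operations in Bernstein spaces -/

theorem bernsteinSpace_smul {σ : ℝ} {p : ℝ≥0∞} {f : ℂ → ℂ} (c : ℂ) (hf : f ∈ bernsteinSpace σ p) :
    (fun z => c * f z) ∈ bernsteinSpace σ p := by
  obtain ⟨f1, f2, f3, f4, f5⟩ := hf
  refine ⟨f1.const_mul c, fun ε hε => ?_, f3.const_mul c, by simpa using f4.const_mul c,
    f5.const_mul c⟩
  obtain ⟨C, hC⟩ := f2 ε hε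
  refine ⟨‖c‖ * C, fun z => ?_⟩
  rw [norm_mul, mul_assoc]
  gcongr
  exact hC z

theorem bernsteinSpace_sub {σ : ℝ} {p : ℝ≥0∞} {f g : ℂ → ℂ} (hf : f ∈ bernsteinSpace σ p)
    (hg : g ∈ bernsteinSpace σ p) : f - g ∈ bernsteinSpace σ p := by
  obtain ⟨f1, f2, f3, f4, f5⟩ := hf
  obtain ⟨g1, g2, g3, g4, g5⟩ := hg
  refine ⟨f1.sub g1, fun ε hε => ?_, f3.sub g3, by simpa using f4.sub g4, f5.sub g5⟩
  obtain ⟨C, hC⟩ := f2 ε hε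
  obtain ⟨D, hD⟩ := g2 ε hε
  refine ⟨C + D, fun z => (norm_sub_le _ _).trans ?_⟩
  rw [add_mul]
  exact add_le_add (hC z) (hD z)

/-! ### Unboundedness of interpolation, modulo signals of bounded length -/

theorem integral_abs_sin_pi_mul_sub (a : ℤ) (x : ℝ) :
    ∫ t in x..x + 1, |Real.sin (Real.pi * (t - a))| = 2 / Real.pi := by
  have hp : Function.Periodic (fun t : ℝ => |Real.sin (Real.pi * (t - a))|) 1 := by
    intro t
    have : Real.pi * (t + 1 - a) = Real.pi * (t - a) + Real.pi := by ring
    simp only [this, Real.sin_add_pi, abs_neg]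
  rw [hp.intervalIntegral_add_eq x a, intervalIntegral.integral_comp_sub_right
    (fun t : ℝ => |Real.sin (Real.pi * t)|) (a : ℝ), sub_self, add_sub_cancel_left]
  have : ∫ t in (0 : ℝ)..1, |Real.sin (Real.pi * t)| = ∫ t in (0 : ℝ)..1, Real.sin (Real.pi * t) := by
    refine intervalIntegral.integral_congr fun t ht => ?_
    rw [Set.uIcc_of_le zero_le_one] at ht
    refine abs_of_nonneg (Real.sin_nonneg_of_nonneg_of_le_pi ?_ ?_)
    · exact mul_nonneg Real.pi_pos.le ht.1
    · exact mul_le_of_le_one_right Real.pi_pos.le ht.2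
  rw [this, intervalIntegral.integral_comp_mul_left (fun t => Real.sin t) Real.pi_ne_zero]
  simp
  ring

/-- Between the nodes the rational factor is `R / ((t - a) * (a + R - t))`; here `t - a < m + 1` and
`a + R - t ≤ R`. -/
theorem le_norm_csincPair {a : ℤ} {R m : ℕ} (hR : Odd R) (hm : m < R) {t : ℝ}
    (ht : t ∈ Set.Ioo ((a : ℝ) + m) (a + m + 1)) :
    (1 / (Real.pi * (m + 1))) * |Real.sin (Real.pi * (t - a))| ≤ ‖csincPair a (a + R) t‖ := by
  obtain ⟨h1, h2⟩ := ht
  have hmR : (m : ℝ) + 1 ≤ R := by exact_mod_cast hm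
  have hm0 : (0 : ℝ) ≤ m := m.cast_nonneg
  have ta : 0 < t - a := by linarith
  have tb : 0 < a + R - t := by linarith
  have hodd : Odd ((a + R : ℤ) - a) := by
    rw [add_sub_cancel_left]; exact_mod_cast hR
  have e1 : (t : ℂ) ≠ a := by
    intro h
    have : t = a := by exact_mod_cast h
    linarith
  have e2 : (t : ℂ) ≠ ((a + R : ℤ) : ℂ) := by
    intro h
    have : t = a + R := by exact_mod_cast h
    linarith
  have e3 : csincPair a (a + R) t
      = ((Real.sin (Real.pi * (t - a)) / Real.pi * (R / ((t - a) * (a + R - t))) : ℝ) : ℂ) := by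
    rw [csincPair_eq hodd e1 e2]
    push_cast
    rw [show ((a : ℂ) - (a + R)) = -R by ring,
      show ((t : ℂ) - a) * (t - (a + R)) = -((t - a) * (a + R - t)) by ring, neg_div_neg_eq]
  have hpi := Real.pi_pos
  rw [e3, Complex.norm_real, norm_mul, norm_div, Real.norm_eq_abs, Real.norm_of_nonneg hpi.le,
    Real.norm_of_nonneg (by positivity)]
  have h3 : 1 / ((m : ℝ) + 1) ≤ R / ((t - a) * (a + R - t)) := by
    rw [div_le_div_iff₀ (by positivity) (by positivity), one_mul, mul_comm (R : ℝ)]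
    gcongr <;> linarith
  calc _ = |Real.sin (Real.pi * (t - a))| / Real.pi * (1 / ((m : ℝ) + 1)) := by
        field_simp
    _ ≤ _ := by gcongr

/-- Each unit cell between the nodes contributes at least `1 / (π * (m + 1)) * (2 / π)`. The sum is
logarithmic in the gap, although the samples have `ℓ^1`-norm 2. -/
theorem harmonic_le_integral_norm_csincPair (a : ℤ) {R : ℕ} (hR : Odd R) :
    2 / Real.pi ^ 2 * (harmonic R : ℝ) ≤ ∫ t in (a : ℝ)..a + R, ‖csincPair a (a + R) t‖ := by
  have hc : Continuous fun t : ℝ => ‖csincPair a (a + R) t‖ :=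
    ((differentiable_csincPair a _).continuous.comp Complex.continuous_ofReal).norm
  have hs := intervalIntegral.sum_integral_adjacent_intervals (μ := volume)
    (f := fun t : ℝ => ‖csincPair a (a + R) t‖) (a := fun m : ℕ => (a : ℝ) + m) (n := R)
    (fun m _ => hc.intervalIntegrable _ _)
  rw [Nat.cast_zero, add_zero] at hs
  rw [← hs, harmonic, Rat.cast_sum, Finset.mul_sum]
  refine Finset.sum_le_sum fun m hm => ?_
  rw [Finset.mem_range] at hm
  have h1 : ∫ t in (a : ℝ) + m..a + m + 1, 1 / (Real.pi * (m + 1)) * |Real.sin (Real.pi * (t - a))|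
      = 2 / Real.pi ^ 2 * (((m + 1 : ℕ) : ℚ)⁻¹ : ℚ) := by
    rw [intervalIntegral.integral_const_mul, integral_abs_sin_pi_mul_sub]
    have := Real.pi_ne_zero
    push_cast
    field_simp
  rw [← h1]
  push_cast
  rw [← add_assoc]
  refine intervalIntegral.integral_mono_on_of_le_Ioo (by linarith) ?_
    (hc.intervalIntegrable _ _) fun t ht => le_norm_csincPair hR hm ht
  apply Continuous.intervalIntegrable
  fun_prop

/-- The distance of the two nodes of `spike N`. -/
def nodeGap (N : ℕ) : ℕ := 2 ^ (2 ^ (N + 3)) + 1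

/-- The left node of `spike N`. -/
def leftNode (N : ℕ) : ℕ := N + 64 * nodeGap N * (2 * N + 1)

/-- The right node of `spike N`. -/
def rightNode (N : ℕ) : ℕ := leftNode N + nodeGap N

/-- Signals whose samples have `ℓ^1`-norm `2 * 2⁻ᴺ`, with large norm in `B_π^1` away from the
origin. -/
noncomputable def spike (N : ℕ) : ℂ → ℂ :=
  fun z => ((1 / 2 : ℝ) ^ N : ℝ) * csincPair (leftNode N) (rightNode N) z

/-- The samples of `spike N`. -/
noncomputable def spikeSample (N : ℕ) (k : ℤ) : ℝ :=
  if k = leftNode N ∨ k = rightNode N then (1 / 2) ^ N else 0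

theorem odd_nodeGap (N : ℕ) : Odd (nodeGap N) := by
  rw [nodeGap]
  exact (Even.pow_of_ne_zero even_two (by positivity)).add_one

theorem lt_leftNode (N : ℕ) : N < leftNode N := by
  have : 0 < nodeGap N := Nat.succ_pos _
  rw [leftNode]
  exact Nat.lt_add_of_pos_right (by positivity)

theorem leftNode_lt_rightNode (N : ℕ) : leftNode N < rightNode N :=
  Nat.lt_add_of_pos_right (Nat.succ_pos _)

theorem spike_mem_bernsteinSpace (N : ℕ) : spike N ∈ bernsteinSpace Real.pi 1 := by
  refine bernsteinSpace_smul _ (csincPair_mem_bernsteinSpace ?_)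
  have : ((rightNode N : ℤ) - leftNode N) = nodeGap N := by
    rw [rightNode]; push_cast; ring
  rw [this]
  exact_mod_cast odd_nodeGap N

theorem spike_intCast (N : ℕ) (k : ℤ) :
    spike N k = spikeSample N k := by
  have hne : (leftNode N : ℤ) ≠ rightNode N := by exact_mod_cast (leftNode_lt_rightNode N).ne
  rw [spike, spikeSample, csincPair, ← Int.cast_sub, ← Int.cast_sub, csinc_intCast, csinc_intCast]
  by_cases h1 : k = leftNode N
  · have h2 : k ≠ rightNode N := h1 ▸ hne
    rw [if_pos (sub_eq_zero.2 h1), if_neg (sub_ne_zero.2 h2), if_pos (Or.inl h1)]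
    simp
  · rw [if_neg (sub_ne_zero.2 h1), zero_add]
    by_cases h2 : k = rightNode N
    · rw [if_pos (sub_eq_zero.2 h2), if_pos (Or.inr h2)]
      simp
    · rw [if_neg (sub_ne_zero.2 h2), if_neg (by tauto), mul_zero, Complex.ofReal_zero]

/-- The logarithm of the doubly exponential gap compensates for the weight 2⁻ᴺ. -/
theorem half_lt_integral_norm_spike (N : ℕ) :
    1 / 2 < ∫ t in (leftNode N : ℝ)..rightNode N, ‖spike N t‖ := by
  have h := harmonic_le_integral_norm_csincPair (leftNode N) (odd_nodeGap N)
  have e : ((leftNode N : ℤ) : ℝ) + nodeGap N = rightNode N := by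
    rw [rightNode]; push_cast; rfl
  have e2 : (leftNode N : ℤ) + nodeGap N = rightNode N := by
    rw [rightNode]; push_cast; rfl
  rw [e, e2, Int.cast_natCast] at h
  simp only [spike, norm_mul, Complex.norm_real]
  rw [intervalIntegral.integral_const_mul, Real.norm_of_nonneg (by positivity)]
  have hl := log_add_one_le_harmonic (nodeGap N)
  -- The logarithm is at least `8 * 2 ^ N * log 2`, and `8 * log 2 > 5`; the factor 5 is then
  -- consumed by `2 / π ^ 2 ≥ 1 / 5`.
  have hl2 : (2 : ℝ) ^ N * 5 ≤ Real.log ((nodeGap N + 1 : ℕ) : ℝ) := by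
    calc (2 : ℝ) ^ N * 5 ≤ ((2 ^ (N + 3) : ℕ) : ℝ) * Real.log 2 := by
          have := Real.log_two_gt_d9
          have h2 : (0 : ℝ) < 2 ^ N := by positivity
          push_cast
          rw [pow_add]
          nlinarith
      _ = Real.log (2 ^ (2 ^ (N + 3)) : ℝ) := (Real.log_pow _ _).symm
      _ ≤ _ := by
          apply Real.log_le_log (by positivity)
          rw [nodeGap]
          push_cast
          linarith
  have h3 : 1 / 5 ≤ 2 / Real.pi ^ 2 := by
    rw [div_le_div_iff₀ (by norm_num) (by have := Real.pi_pos; positivity)]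
    nlinarith [Real.pi_lt_d2, Real.pi_pos]
  have h4 : (2 : ℝ) ^ N ≤ ∫ t in (leftNode N : ℝ)..rightNode N,
      ‖csincPair (leftNode N) (rightNode N) t‖ := by
    refine le_trans ?_ h
    have h5 : (2 : ℝ) ^ N * 5 ≤ (harmonic (nodeGap N) : ℝ) := hl2.trans hl
    calc (2 : ℝ) ^ N = 1 / 5 * (2 ^ N * 5) := by ring
      _ ≤ _ := by gcongr
  calc (1 / 2 : ℝ) < 1 := by norm_num
    _ = (1 / 2 : ℝ) ^ N * 2 ^ N := by rw [← mul_pow]; norm_num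
    _ ≤ _ := by gcongr

/-! ### Short sampling series do not approximate spikes -/

theorem norm_elementarySignal_le {L : ℕ} {c : ℤ → ℂ} {A D : ℝ} {t : ℝ}
    (hc : ∀ k ∈ Finset.Icc (-(L : ℤ)) L, ‖c k‖ ≤ A) (hD : 0 < D) (ht : L + D ≤ t) :
    ‖elementarySignal L c t‖ ≤ (2 * L + 1) * (A * (1 / D)) := by
  refine (norm_sum_le_of_le (f := fun k : ℤ => c k * csinc (t - k)) (n := fun _ => A * (1 / D)) _
    fun k hk => ?_).trans (le_of_eq ?_)
  · have hk' : (k : ℝ) ≤ L := by exact_mod_cast (Finset.mem_Icc.1 hk).2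
    have hA : 0 ≤ A := (norm_nonneg _).trans (hc k hk)
    rw [norm_mul]
    have e : (t : ℂ) - k = ((t - k : ℝ) : ℂ) := by push_cast; rfl
    rw [e]
    have h1 := norm_csinc_ofReal_le (t := t - k) (by linarith)
    refine mul_le_mul (hc k hk) (h1.trans ?_) (norm_nonneg _) hA
    gcongr
    linarith
  · rw [Finset.sum_const, Int.card_Icc, nsmul_eq_mul]
    congr 1
    have : ((L : ℤ) + 1 - -(L : ℤ)).toNat = 2 * L + 1 := by omega
    rw [this]
    push_cast
    ring

theorem elementarySignal_intCast (L : ℕ) (c : ℤ → ℂ) (k : ℤ) :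
    elementarySignal L c k = elementarySequence L c k := by
  rw [elementarySignal, elementarySequence]
  simp only [← Int.cast_sub, csinc_intCast, sub_eq_zero, mul_ite, mul_one, mul_zero,
    Finset.sum_ite_eq, Finset.mem_Icc]

/-- Closeness to the spike would bound the coefficients, since the spike vanishes at every node of
the series. The series would then be too small between the spike's nodes to account for the mass
there. -/
theorem quarter_lt_bernsteinNorm_spike_sub {N L : ℕ} (hLN : L ≤ N) {c : ℤ → ℂ}
    (hg : elementarySignal L c ∈ bernsteinSpace Real.pi 1) :
    (1 / 2 : ℝ≥0∞) ^ 2 < bernsteinNorm 1 (spike N - elementarySignal L c) := by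
  by_contra! hle
  have hf := spike_mem_bernsteinSpace N
  have hh := bernsteinSpace_sub hf hg
  have hi : Integrable (fun t : ℝ => (spike N - elementarySignal L c) t) :=
    memLp_one_iff_integrable.1 hh.2.2.2.2
  have hJ : ∫ t : ℝ, ‖(spike N - elementarySignal L c) t‖ ≤ 1 / 4 := by
    rw [bernsteinNorm, eLpNorm_one_eq_lintegral_enorm, ← ofReal_integral_norm_eq_lintegral_enorm hi]
      at hle
    have : (1 / 2 : ℝ≥0∞) ^ 2 = ENNReal.ofReal (1 / 4) := by
      rw [show (1 / 4 : ℝ) = (1 / 2) ^ 2 by norm_num, ENNReal.ofReal_pow (by norm_num),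
        ENNReal.ofReal_div_of_pos (by norm_num)]
      simp
    rw [this] at hle
    exact (ENNReal.ofReal_le_ofReal_iff (by norm_num)).1 hle
  have hexp : Real.exp Real.pi ≤ 56 := by
    have h1 : Real.exp Real.pi ≤ Real.exp 1 ^ 4 := by
      rw [← Real.exp_nat_mul]
      gcongr
      push_cast
      linarith [Real.pi_le_four]
    have h2 : Real.exp 1 ^ 4 ≤ 2.72 ^ 4 := by
      gcongr
      linarith [Real.exp_one_lt_d9]
    linarith [show (2.72 : ℝ) ^ 4 ≤ 56 by norm_num]
  -- As `|k| ≤ L ≤ N < leftNode N`, the sample of the difference at `k` is `-c k`; the Nikolskii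
  -- inequality bounds it by `exp π * (1 / 4) ≤ 56 / 4`.
  have hck : ∀ k ∈ Finset.Icc (-(L : ℤ)) L, ‖c k‖ ≤ 14 := by
    intro k hk
    have hk' := Finset.mem_Icc.1 hk
    have hl := lt_leftNode N
    have hr := leftNode_lt_rightNode N
    have h1 : ‖(spike N - elementarySignal L c) ((k : ℝ) : ℂ)‖ = ‖c k‖ := by
      rw [Pi.sub_apply, Complex.ofReal_intCast, spike_intCast, spikeSample, if_neg (by omega),
        elementarySignal_intCast, elementarySequence, if_pos hk', Complex.ofReal_zero, zero_sub, norm_neg]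
    have h2 := norm_le_exp_mul_integral_norm Real.pi_pos hh k
    rw [h1] at h2
    nlinarith [Real.exp_pos Real.pi]
  have hR : (0 : ℝ) < nodeGap N := by rw [nodeGap]; positivity
  have hab : (leftNode N : ℝ) ≤ rightNode N := by exact_mod_cast (leftNode_lt_rightNode N).le
  have hLN' : (L : ℝ) ≤ N := by exact_mod_cast hLN
  -- The offset `64 * nodeGap N * (2 * N + 1)` in `leftNode` serves this bound: the `2 * L + 1`
  -- terms add up to at most `14 / (64 * nodeGap N)`, and `14 ≤ 16`.
  have hgt : ∀ t ∈ Set.Icc (leftNode N : ℝ) (rightNode N),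
      ‖elementarySignal L c t‖ ≤ 1 / (4 * nodeGap N) := by
    intro t ht
    have hN : (0 : ℝ) ≤ N := N.cast_nonneg
    refine (norm_elementarySignal_le hck (D := 64 * nodeGap N * (2 * N + 1)) (by positivity)
      ?_).trans ?_
    · have := ht.1
      rw [leftNode] at this
      push_cast at this
      linarith
    · rw [mul_one_div, mul_div_assoc', div_le_div_iff₀ (by positivity) (by positivity)]
      nlinarith
  have fc : Continuous fun t : ℝ => spike N t := hf.1.continuous.comp Complex.continuous_ofReal
  have gc : Continuous fun t : ℝ => elementarySignal L c t :=
    hg.1.continuous.comp Complex.continuous_ofReal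
  have I1 : ∫ t in (leftNode N : ℝ)..rightNode N, ‖spike N t‖
      ≤ ∫ t in (leftNode N : ℝ)..rightNode N,
        (‖(spike N - elementarySignal L c) t‖ + 1 / (4 * nodeGap N)) := by
    refine intervalIntegral.integral_mono_on hab (fc.norm.intervalIntegrable _ _)
      (((fc.sub gc).norm.add continuous_const).intervalIntegrable _ _) fun t ht => ?_
    have := norm_le_norm_sub_add (spike N t) (elementarySignal L c t)
    rw [Pi.sub_apply]
    linarith [hgt t ht]
  have hc : Continuous fun t : ℝ => ‖(spike N - elementarySignal L c) t‖ := (fc.sub gc).norm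
  rw [intervalIntegral.integral_add (hc.intervalIntegrable _ _)
    (continuous_const.intervalIntegrable _ _), intervalIntegral.integral_const] at I1
  have I2 : ∫ t in (leftNode N : ℝ)..rightNode N, ‖(spike N - elementarySignal L c) t‖ ≤ 1 / 4 := by
    rw [intervalIntegral.integral_of_le hab]
    exact (setIntegral_le_integral hi.norm (Eventually.of_forall fun _ => norm_nonneg _)).trans hJ
  have I3 : ((rightNode N : ℝ) - leftNode N) • (1 / (4 * (nodeGap N : ℝ))) = 1 / 4 := by
    rw [rightNode]
    push_cast
    rw [add_sub_cancel_left, smul_eq_mul]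
    field_simp
  -- The contradiction is `1 / 2 < ∫ ‖spike‖ ≤ 1 / 4 + 1 / 4`.
  rw [I3] at I1
  linarith [half_lt_integral_norm_spike N]

/-! ### Uniform programs -/

/-- The s-m-n theorem: currying hard-wires the parameter into one fixed program. The reduction needs
descriptions that depend computably on `e`. -/
theorem exists_computable_program {α ι : Type} [Primcodable α] [Primcodable ι] {g : α → ι → ℕ}
    (hg : Computable₂ g) :
    ∃ P : α → Program, Computable P ∧ ∀ a, Computes (P a) (g a) := by
  obtain ⟨c, hc⟩ := Nat.Partrec.Code.exists_code.1 (show Nat.Partrec _ from hg)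
  refine ⟨fun a => Nat.Partrec.Code.curry c (Encodable.encode a), ?_, fun a i => ?_⟩
  · exact (Nat.Partrec.Code.primrec₂_curry.comp (Primrec.const c) Primrec.encode).to_comp
  · rw [Nat.Partrec.Code.eval_curry, hc, ← Encodable.encode_prod_val]
    simp [PFun.coe_val]

theorem computes_zero {ι : Type} [Primcodable ι] :
    Computes Nat.Partrec.Code.zero (fun _ : ι => 0) := fun i => by
  simp [Nat.Partrec.Code.eval, pure, PFun.pure]

theorem computes_const {ι : Type} [Primcodable ι] (n : ℕ) :
    Computes (Nat.Partrec.Code.const n) (fun _ : ι => n) := fun i => by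
  rw [Nat.Partrec.Code.eval_const]
  exact Part.mem_some _

theorem computes_succ : Computes Nat.Partrec.Code.succ (fun n : ℕ => n + 1) := fun n => by
  simp [Nat.Partrec.Code.eval]

/-- Exact descriptions of nonnegative rational numbers. -/
theorem describesReal_of_ratio {ι : Type} [Primcodable ι] {P Q : Program} {nu de : ι → ℕ}
    (hP : Computes P fun p : ι × ℕ => nu p.1) (hQ : Computes Q fun p : ι × ℕ => de p.1)
    (hde : ∀ i, de i ≠ 0) {x : ι → ℝ} (hx : ∀ i, x i = nu i / de i) :
    DescribesReal ((Nat.Partrec.Code.zero, P, Q), Nat.Partrec.Code.zero) x := by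
  refine ⟨fun p => nu p.1 / de p.1, fun _ => 0,
    ⟨fun _ => 0, _, _, computes_zero, hP, hQ, fun p => ⟨hde p.1, by simp⟩⟩,
    computes_zero, fun i n M _ => ?_⟩
  rw [hx]
  push_cast
  rw [sub_self, abs_zero]
  positivity

/-! ### The running time of a program -/

/-- The number of steps after which `e` is known to halt on input `0`, capped at `n`. -/
def haltStep (e : Program) : ℕ → ℕ
  | 0 => 0
  | n + 1 => if (Nat.Partrec.Code.evaln (haltStep e n) e 0).isSome then haltStep e n
      else haltStep e n + 1

theorem haltStep_eq_self {e : Program} {n : ℕ}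
    (h : ∀ m < n, (Nat.Partrec.Code.evaln m e 0).isSome = false) : haltStep e n = n := by
  induction n with
  | zero => rfl
  | succ n ih =>
    rw [haltStep, ih fun m hm => h m (by omega), h n (by omega)]
    rfl

/-- The counter tests its own value as the step bound, so it freezes at the first success. Thus
`haltStep e n < n` is the decidable sign that halting has been detected. -/
theorem haltStep_eq_of_le {e : Program} {N n : ℕ}
    (h : ∀ m < N, (Nat.Partrec.Code.evaln m e 0).isSome = false)
    (hN : (Nat.Partrec.Code.evaln N e 0).isSome) (hn : N ≤ n) : haltStep e n = N := by
  induction n, hn using Nat.le_induction with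
  | base => exact haltStep_eq_self h
  | succ n _ ih => rw [haltStep, ih, if_pos hN]

theorem primrec₂_haltStep : Primrec₂ haltStep := by
  have h : Primrec₂ fun (a : Program × ℕ) (p : ℕ × ℕ) =>
      if (Nat.Partrec.Code.evaln p.2 a.1 0).isSome then p.2 else p.2 + 1 := by
    have h2 : Primrec fun q : (Program × ℕ) × ℕ × ℕ => q.2.2 := Primrec.snd.comp Primrec.snd
    have h3 : Primrec fun q : (Program × ℕ) × ℕ × ℕ =>
        Nat.Partrec.Code.evaln q.2.2 q.1.1 0 :=
      Nat.Partrec.Code.primrec_evaln.comp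
        (((h2.pair (Primrec.fst.comp Primrec.fst))).pair (Primrec.const 0))
    exact Primrec.ite (Primrec.eq.comp (Primrec.option_isSome.comp h3) (Primrec.const true)) h2
      (Primrec.succ.comp h2)
  refine (Primrec.nat_rec' (f := fun a : Program × ℕ => a.2) (g := fun _ => 0) Primrec.snd
    (Primrec.const 0) h).of_eq fun a => ?_
  obtain ⟨e, n⟩ := a
  change _ = haltStep e n
  induction n with
  | zero => rfl
  | succ n ih => simp only [haltStep, ← ih]

/-! ### Primitive recursiveness of the nodes -/

theorem primrec_two_pow : Primrec fun n : ℕ => 2 ^ n := by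
  refine (Primrec.nat_rec₁ (f := fun _ m => 2 * m) 1
    (Primrec.nat_mul.comp (Primrec.const 2) Primrec.snd)).of_eq fun n => ?_
  induction n with
  | zero => rfl
  | succ n ih => simp only [pow_succ, ← ih]; ring

theorem primrec_nodeGap : Primrec nodeGap :=
  Primrec.succ.comp (primrec_two_pow.comp (primrec_two_pow.comp
    (Primrec.nat_add.comp Primrec.id (Primrec.const 3))))

theorem primrec_leftNode : Primrec leftNode :=
  Primrec.nat_add.comp Primrec.id (Primrec.nat_mul.comp
    (Primrec.nat_mul.comp (Primrec.const 64) primrec_nodeGap)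
    (Primrec.succ.comp (Primrec.nat_mul.comp (Primrec.const 2) Primrec.id)))

theorem primrec_rightNode : Primrec rightNode :=
  Primrec.nat_add.comp primrec_leftNode primrec_nodeGap

theorem primrec_intCast : Primrec fun n : ℕ => (n : ℤ) :=
  Primrec.encode_iff.1 <| (Primrec.nat_mul.comp (Primrec.const 2) Primrec.id).of_eq fun _ => rfl

/-! ### Signals that depend on the running time of a program -/

/-- The zero signal as long as `e` is not known to halt, a spike afterwards. -/
noncomputable def haltSignal (e : Program) (n : ℕ) : ℂ → ℂ :=
  if haltStep e n < n then spike (haltStep e n) else 0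

/-- The numerators of the samples of `haltSignal e n`. -/
def haltNumerator (e : Program) (p : ℕ × ℤ) : ℕ :=
  if haltStep e p.1 < p.1 ∧
    (p.2 = leftNode (haltStep e p.1) ∨ p.2 = rightNode (haltStep e p.1)) then 1 else 0

theorem haltSignal_mem_bernsteinSpace (e : Program) (n : ℕ) :
    haltSignal e n ∈ bernsteinSpace Real.pi 1 := by
  rw [haltSignal]
  split_ifs
  · exact spike_mem_bernsteinSpace _
  · convert bernsteinSpace_smul 0 (spike_mem_bernsteinSpace 0) using 1
    funext z
    simp

/-- This fraction form permits exact rational descriptions. Before halting is detected the numerator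
is 0, so the denominator is harmless. -/
theorem haltSignal_intCast (e : Program) (n : ℕ) (k : ℤ) :
    haltSignal e n k
      = (((haltNumerator e (n, k) : ℝ) / ((2 ^ haltStep e n : ℕ) : ℝ) : ℝ) : ℂ) := by
  rw [haltSignal, haltNumerator]
  by_cases h : haltStep e n < n
  · rw [if_pos h, spike_intCast, spikeSample]
    by_cases h2 : k = leftNode (haltStep e n) ∨ k = rightNode (haltStep e n)
    · rw [if_pos h2, if_pos ⟨h, h2⟩]
      simp
    · rw [if_neg h2, if_neg fun h3 => h2 h3.2]
      simp
  · rw [if_neg h, if_neg fun h3 => h h3.1]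
    simp

theorem haltSignal_intCast_eq_zero (e : Program) (n : ℕ) {k : ℤ}
    (hk : ¬(-(rightNode (haltStep e n) : ℤ) ≤ k ∧ k ≤ rightNode (haltStep e n))) :
    haltSignal e n k = 0 := by
  have := leftNode_lt_rightNode (haltStep e n)
  rw [haltSignal_intCast, haltNumerator, if_neg]
  · simp
  · rintro ⟨-, h⟩
    dsimp only at h
    omega

theorem elementarySequence_haltSignal (e : Program) (n : ℕ) :
    elementarySequence (rightNode (haltStep e n)) (fun k => haltSignal e n k)
      = fun k : ℤ => haltSignal e n k := by
  funext k
  rw [elementarySequence]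
  split_ifs with h
  · rfl
  · exact (haltSignal_intCast_eq_zero e n h).symm

/-- A spike is its own finite Shannon series with two nonzero terms, so the same programs serve both
in discrete and in continuous time. -/
theorem elementarySignal_haltSignal (e : Program) (n : ℕ) :
    elementarySignal (rightNode (haltStep e n)) (fun k => haltSignal e n k) = haltSignal e n := by
  have hlt := leftNode_lt_rightNode (haltStep e n)
  by_cases h : haltStep e n < n
  · simp only [haltSignal, if_pos h]
    funext z
    have hne : (leftNode (haltStep e n) : ℤ) ≠ rightNode (haltStep e n) := by exact_mod_cast hlt.ne
    rw [elementarySignal, ← Finset.sum_subset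
      (s₁ := {(leftNode (haltStep e n) : ℤ), (rightNode (haltStep e n) : ℤ)}), Finset.sum_pair hne,
      spike_intCast, spike_intCast, spikeSample, spikeSample, if_pos (Or.inl rfl),
      if_pos (Or.inr rfl), spike, csincPair, mul_add]
    · intro k hk
      rw [Finset.mem_insert, Finset.mem_singleton] at hk
      rw [Finset.mem_Icc]
      omega
    · intro k _ hk
      rw [Finset.mem_insert, Finset.mem_singleton] at hk
      rw [spike_intCast, spikeSample, if_neg hk, Complex.ofReal_zero, zero_mul]
  · simp only [haltSignal, if_neg h]
    funext z
    simp [elementarySignal]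

/-- What the limit of `haltSignal e` looks like. -/
theorem exists_haltSignal_limit (e : Program) :
    ∃ f : ℂ → ℂ, (∀ n, haltSignal e n = f ∨ haltSignal e n = 0 ∧ ∃ N, n ≤ N ∧ f = spike N) ∧
      (∃ N, ∀ n, N ≤ n → haltSignal e n = f) ∧
      ∀ N, (∀ m < N, (Nat.Partrec.Code.evaln m e 0).isSome = false) →
        (Nat.Partrec.Code.evaln N e 0).isSome → f = spike N := by
  by_cases h : ∃ N, (Nat.Partrec.Code.evaln N e 0).isSome
  · have hN := Nat.find_spec h
    have hlt : ∀ m < Nat.find h, (Nat.Partrec.Code.evaln m e 0).isSome = false := fun m hm => by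
      simpa using Nat.find_min h hm
    -- At `n = Nat.find h` the counter still equals `n` and the signal is still zero; the spike
    -- appears one index later.
    refine ⟨spike (Nat.find h), fun n => ?_, ⟨Nat.find h + 1, fun n hn => ?_⟩, fun N h1 h2 => ?_⟩
    · rcases lt_or_ge (Nat.find h) n with hn | hn
      · left
        rw [haltSignal, haltStep_eq_of_le hlt hN hn.le, if_pos hn]
      · right
        refine ⟨?_, _, hn, rfl⟩
        rw [haltSignal, haltStep_eq_self fun m hm => hlt m (by omega), if_neg (lt_irrefl _)]
    · rw [haltSignal, haltStep_eq_of_le hlt hN (by omega), if_pos (by omega)]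
    · congr 1
      rw [Nat.find_eq_iff]
      exact ⟨h2, fun m hm => by simp [h1 m hm]⟩
  · push Not at h
    have h0 : ∀ n, haltSignal e n = 0 := fun n => by
      rw [haltSignal, haltStep_eq_self fun m _ => by simpa using h m, if_neg (lt_irrefl _)]
    exact ⟨0, fun n => Or.inl (h0 n), ⟨0, fun n _ => h0 n⟩, fun N _ h2 => absurd h2 (h N)⟩

/-! ### Descriptions of the samples and of the limit signal -/

theorem tsum_enorm_spike_le (N : ℕ) :
    ∑' k : ℤ, ‖spike N k‖ₑ ≤ 2 * (1 / 2 : ℝ≥0∞) ^ N := by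
  have hne : (leftNode N : ℤ) ≠ rightNode N := by exact_mod_cast (leftNode_lt_rightNode N).ne
  have hn : ‖(((1 / 2 : ℝ) ^ N : ℝ) : ℂ)‖ₑ = (1 / 2 : ℝ≥0∞) ^ N := by
    rw [← ofReal_norm, Complex.norm_real, Real.norm_of_nonneg (by positivity),
      ENNReal.ofReal_pow (by norm_num), ENNReal.ofReal_div_of_pos (by norm_num)]
    simp
  rw [tsum_eq_sum (s := {(leftNode N : ℤ), (rightNode N : ℤ)}), Finset.sum_pair hne, spike_intCast,
    spike_intCast, spikeSample, spikeSample, if_pos (Or.inl rfl), if_pos (Or.inr rfl), hn, two_mul]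
  intro k hk
  rw [Finset.mem_insert, Finset.mem_singleton] at hk
  rw [spike_intCast, spikeSample, if_neg hk, Complex.ofReal_zero, enorm_zero]

theorem memℓp_haltSignal (e : Program) (n : ℕ) : Memℓp (fun k : ℤ => haltSignal e n k) 1 := by
  refine Memℓp.of_exponent_ge (q := 0) ?_ zero_le_one
  rw [memℓp_zero_iff]
  refine (Set.finite_Icc (-(rightNode (haltStep e n) : ℤ)) (rightNode (haltStep e n))).subset ?_
  intro k hk
  by_contra h
  exact hk (haltSignal_intCast_eq_zero e n h)

theorem primrec₂_haltNumerator : Primrec₂ haltNumerator := by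
  have hn : Primrec fun q : Program × ℕ × ℤ => q.2.1 := Primrec.fst.comp Primrec.snd
  have hk : Primrec fun q : Program × ℕ × ℤ => q.2.2 := Primrec.snd.comp Primrec.snd
  have hs : Primrec fun q : Program × ℕ × ℤ => haltStep q.1 q.2.1 :=
    primrec₂_haltStep.comp Primrec.fst hn
  exact Primrec.ite ((Primrec.nat_lt.comp hs hn).and
    ((Primrec.eq.comp hk (primrec_intCast.comp (primrec_leftNode.comp hs))).or
      (Primrec.eq.comp hk (primrec_intCast.comp (primrec_rightNode.comp hs)))))
    (Primrec.const 1) (Primrec.const 0)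

/-- Programs for the sequences `haltSignal e`, uniformly in `e`. -/
theorem exists_computable_haltSignal_program :
    ∃ P : Program → Program × ComplexProgram, Computable P ∧ ∀ e,
      Computes (P e).1 (fun n => rightNode (haltStep e n)) ∧
      DescribesComplex (P e).2 (fun p : ℕ × ℤ => haltSignal e p.1 p.2) := by
  obtain ⟨PL, hPL, hL⟩ := exists_computable_program
    (primrec_rightNode.comp₂ primrec₂_haltStep).to_comp
  obtain ⟨Pnu, hPnu, hnu⟩ := exists_computable_program
    (g := fun (e : Program) (p : (ℕ × ℤ) × ℕ) => haltNumerator e p.1)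
    (primrec₂_haltNumerator.comp Primrec.fst (Primrec.fst.comp Primrec.snd)).to_comp
  obtain ⟨Pde, hPde, hde⟩ := exists_computable_program
    (g := fun (e : Program) (p : (ℕ × ℤ) × ℕ) => 2 ^ haltStep e p.1.1)
    (primrec_two_pow.comp (primrec₂_haltStep.comp Primrec.fst
      (Primrec.fst.comp (Primrec.fst.comp Primrec.snd)))).to_comp
  refine ⟨fun e => (PL e, (((Nat.Partrec.Code.zero, Pnu e, Pde e), Nat.Partrec.Code.zero),
    ((Nat.Partrec.Code.zero, Nat.Partrec.Code.zero, Nat.Partrec.Code.const 1),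
      Nat.Partrec.Code.zero))), ?_, fun e => ⟨hL e, ?_, ?_⟩⟩
  · exact hPL.pair ((((Computable.const _).pair (hPnu.pair hPde)).pair (Computable.const _)).pair
      (Computable.const _))
  · refine describesReal_of_ratio (hnu e)
      (de := fun p => 2 ^ haltStep e p.1) (hde e) (fun p => by positivity) fun p => ?_
    dsimp only
    rw [haltSignal_intCast, Complex.ofReal_re]
  · refine describesReal_of_ratio (nu := fun _ => 0) (de := fun _ => 1) computes_zero
      (computes_const 1) (fun p => one_ne_zero) fun p => ?_
    dsimp only
    rw [haltSignal_intCast, Complex.ofReal_im]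
    simp

/-- From `N` on the approximants equal the limit, so a constant modulus works. That `N` is not
computed from `e`; only the existence of a description is needed to place the limit in
`computableSignals`. -/
theorem describesSignal_of_haltSignal_eq {e : Program} {P : Program × ComplexProgram} {f : ℂ → ℂ}
    {N : ℕ} (hL : Computes P.1 (fun n => rightNode (haltStep e n)))
    (hc : DescribesComplex P.2 (fun p : ℕ × ℤ => haltSignal e p.1 p.2))
    (hf : ∀ n, N ≤ n → haltSignal e n = f) :
    DescribesSignal (P, Nat.Partrec.Code.const N) f := by
  refine ⟨hf N le_rfl ▸ haltSignal_mem_bernsteinSpace e N, _, _, fun _ => N, hL, hc,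
    computes_const N, fun n => ?_, fun n M hn => ?_⟩
  · dsimp only
    rw [elementarySignal_haltSignal]
    exact haltSignal_mem_bernsteinSpace e n
  · dsimp only
    rw [elementarySignal_haltSignal, hf n hn, sub_self, bernsteinNorm]
    simp

/-- If the signal is still zero at `n ≥ M + 1`, a later spike has index `K ≥ n` and samples of norm
at most `2 * 2⁻ᴷ ≤ 2⁻ᴹ`. The modulus `M ↦ M + 1` therefore does not depend on `e`. -/
theorem describesSequence_of_haltSignal {e : Program} {P : Program × ComplexProgram} {f : ℂ → ℂ}
    {N : ℕ} (hL : Computes P.1 (fun n => rightNode (haltStep e n)))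
    (hc : DescribesComplex P.2 (fun p : ℕ × ℤ => haltSignal e p.1 p.2))
    (hf : haltSignal e N = f)
    (hlim : ∀ n, haltSignal e n = f ∨ haltSignal e n = 0 ∧ ∃ N, n ≤ N ∧ f = spike N) :
    DescribesSequence (P, Nat.Partrec.Code.succ) (fun k : ℤ => f k) := by
  refine ⟨hf ▸ memℓp_haltSignal e N, _, _, fun M => M + 1, hL, hc, computes_succ,
    fun n M hn => ?_⟩
  dsimp only
  rw [elementarySequence_haltSignal]
  rcases hlim n with h | ⟨h, K, hK, rfl⟩
  · simp [h]
  · simp only [h, Pi.zero_apply, sub_zero]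
    refine (tsum_enorm_spike_le K).trans ?_
    have h12 : (1 / 2 : ℝ≥0∞) ≤ 1 := by
      rw [one_div]; exact ENNReal.inv_le_one.2 one_le_two
    calc 2 * (1 / 2 : ℝ≥0∞) ^ K ≤ 2 * (1 / 2 : ℝ≥0∞) ^ (M + 1) := by
          gcongr 2 * ?_
          exact pow_le_pow_right_of_le_one' h12 (hn.trans hK)
      _ = (1 / 2 : ℝ≥0∞) ^ M := by
          rw [pow_succ, mul_left_comm, one_div, ENNReal.mul_inv_cancel two_ne_zero
            ENNReal.ofNat_ne_top, mul_one]

/-- A description of the signal with the samples of `spike N` uses a sampling series longer than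
`N`. -/
theorem lt_length_of_describesSignal_spike {N : ℕ} {F : SignalProgram} {L ξ : ℕ}
    (hF : DescribesSignal F (spike N)) (hξ : ξ ∈ F.2.eval 2) (hL : L ∈ F.1.1.eval ξ) : N < L := by
  obtain ⟨-, L', c, ξ', hL', -, hξ', hmem, happ⟩ := hF
  obtain rfl : ξ = ξ' 2 := Part.mem_unique hξ (hξ' 2)
  obtain rfl : L = L' (ξ' 2) := Part.mem_unique hL (hL' _)
  by_contra! hle
  exact absurd (happ _ 2 le_rfl) (quarter_lt_bernsteinNorm_spike_sub hle (hmem _)).not_ge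

/-! ### The reduction from the halting problem -/

theorem interpolation_sampling (p : ℝ≥0∞) (f : bernsteinSpace Real.pi p) :
    interpolation p ⟨sampling p f, f, rfl⟩ = f :=
  Equiv.ofInjective_symm_apply (sampling_injective p) f

theorem theorem2 : ¬ IsTuringComputable (interpolation 1) := by
  rintro ⟨Φ, hΦ, hT⟩
  obtain ⟨P, hP, hPe⟩ := exists_computable_haltSignal_program
  -- `B e` is the length of the series that the output of `Φ` provides for accuracy 2⁻² = 1/4.
  set B : Program →. ℕ := fun e => (Φ (P e, Nat.Partrec.Code.succ)).bind fun F =>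
    (F.2.eval 2).bind fun n => F.1.1.eval n with hB
  have hBp : Partrec B := by
    have h1 : Partrec fun e : Program => Φ (P e, Nat.Partrec.Code.succ) :=
      hΦ.comp (hP.pair (Computable.const _))
    refine h1.bind ?_
    have h2 : Partrec fun q : Program × SignalProgram => q.2.2.eval 2 :=
      Nat.Partrec.Code.eval_part.comp (Computable.snd.comp Computable.snd) (Computable.const 2)
    refine Partrec.bind h2 ?_
    exact Nat.Partrec.Code.eval_part.comp
      (Computable.fst.comp (Computable.fst.comp (Computable.snd.comp Computable.fst)))
      Computable.snd
  -- The input is admissible whether or not `e` halts, so `B` is total and the function chosen from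
  -- it is computable.
  have key : ∀ e, ∃ L ∈ B e, ∀ N,
      (∀ m < N, (Nat.Partrec.Code.evaln m e 0).isSome = false) →
        (Nat.Partrec.Code.evaln N e 0).isSome → N < L := by
    intro e
    obtain ⟨f, hlim, ⟨K, hK⟩, hspike⟩ := exists_haltSignal_limit e
    obtain ⟨hL, hc⟩ := hPe e
    have hf : f ∈ bernsteinSpace Real.pi 1 := hK K le_rfl ▸ haltSignal_mem_bernsteinSpace e K
    obtain ⟨F, hFΦ, hF⟩ := hT (P e, Nat.Partrec.Code.succ) ⟨sampling 1 ⟨f, hf⟩, _, rfl⟩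
      (describesSequence_of_haltSignal hL hc (hK K le_rfl) hlim)
      ⟨⟨f, hf⟩, ⟨_, describesSignal_of_haltSignal_eq hL hc hK⟩, rfl⟩
    rw [interpolation_sampling] at hF
    obtain ⟨-, L, c, ξ, hFL, -, hFξ, -⟩ := id hF
    refine ⟨L (ξ 2), ?_, fun N h1 h2 => ?_⟩
    · rw [hB]
      simp only [Part.mem_bind_iff]
      exact ⟨F, hFΦ, ξ 2, hFξ 2, hFL _⟩
    · obtain rfl := hspike N h1 h2
      exact lt_length_of_describesSignal_spike hF (hFξ 2) (hFL _)
  choose b hb hbN using key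
  have hbc : Computable b := hBp.of_eq fun e => Part.eq_some_iff.2 (hb e)
  -- Since `b e` exceeds the halting bound whenever `e` halts on 0, running `e` with bound `b e`
  -- decides halting.
  refine ComputablePred.halting_problem 0 (ComputablePred.computable_iff.2
    ⟨fun e => (Nat.Partrec.Code.evaln (b e) e 0).isSome, ?_, ?_⟩)
  · exact Primrec.option_isSome.to_comp.comp (Nat.Partrec.Code.primrec_evaln.to_comp.comp
      ((hbc.pair Computable.id).pair (Computable.const 0)))
  · funext e
    refine propext ⟨fun h => ?_, fun h => ?_⟩
    · obtain ⟨x, hx⟩ := Part.dom_iff_mem.1 h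
      have hex : ∃ N, (Nat.Partrec.Code.evaln N e 0).isSome := by
        obtain ⟨k, hk⟩ := Nat.Partrec.Code.evaln_complete.1 hx
        exact ⟨k, Option.isSome_iff_exists.2 ⟨x, hk⟩⟩
      have hlt := hbN e (Nat.find hex) (fun m hm => by simpa using Nat.find_min hex hm)
        (Nat.find_spec hex)
      obtain ⟨y, hy⟩ := Option.isSome_iff_exists.1 (Nat.find_spec hex)
      exact Option.isSome_iff_exists.2 ⟨y, Nat.Partrec.Code.evaln_mono hlt.le hy⟩
    · obtain ⟨y, hy⟩ := Option.isSome_iff_exists.1 h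
      exact Part.dom_iff_mem.2 ⟨y, Nat.Partrec.Code.evaln_sound hy⟩
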